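/- A deterministic finite automaton with output (DFAO) in base $k\ge 2$ generates the sequence ${\bf a}=(a(n))_{n\ge 0}$ whose term $a(n)$ is the output of the state reached after reading the canonical base-$k$ representation of $n$ (most significant digit first, no leading zeros, the representation of $0$ being empty); the sequences that arise are the $k$-automatic sequences. Call a real number $C$ a recurrence constant of ${\bf a}$ if for every $\ell\ge 1$ and every word $x$ of length $\ell$ occurring in ${\bf a}$, any two consecutive occurrences of $x$ in ${\bf a}$ start at positions at distance at most $C\ell$. The sequence ${\bf a}$ is linearly recurrent if it has a recurrence constant; it is recurrent if every factor that occurs in it occurs infinitely often. Let $P({\bf a})$ be the set of pairs $(n,\ell)$ of integers with $\ell\ge 1$ for which some occurrence of some factor of length $\ell$ of ${\bf a}$ is followed by the very next occurrence of that factor at distance $n\geq 1$. (1) There is an algorithm that, given a description of a DFAO (the base $k$ being part of the input), decides whether the sequence ${\bf a}$ that it generates is linearly recurrent. Likewise, there is an algorithm that decides whether ${\bf a}$ is both recurrent and linearly recurrent. (2) For every $k$-automatic sequence ${\bf a}$, the language of canonical base-$k$ encodings of the pairs in $P({\bf a})$ (words over $\{0,\dots,k-1\}^2$, most significant digits first,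 the shorter representation padded with leading zeros) is regular. (3) If ${\bf a}$ is linearly recurrent, then it has a least recurrence constant $C$; it satisfies $$C=\sup\{\, n/\ell : (n,\ell)\in P({\bf a})\,\},$$ it is rational, and there is an algorithm that, given a description of a DFAO generating a linearly recurrent sequence ${\bf a}$, computes a numerator and a denominator of $C$. -/

import Mathlib

/-- The canonical base-`k` representation of `n`: most significant digit first, without leading
zeros; the representation of `0` is the empty word. -/
def canonicalRep (k : ℕ) (hk : 2 ≤ k) (n : ℕ) : List (Fin k) :=
  ((Nat.digits k n).pmap (fun d (h : d < k) => (⟨d, h⟩ : Fin k))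
    (fun _ hd => Nat.digits_lt_base hk hd)).reverse

/-- The canonical encoding of a pair `(m, n)` as a word over pairs of base-`k` digits: the shorter
representation is padded with leading zeros to the length of the longer one. -/
def canonicalPairRep (k : ℕ) (hk : 2 ≤ k) (m n : ℕ) : List (Fin k × Fin k) :=
  let len := max (canonicalRep k hk m).length (canonicalRep k hk n).length
  let zero : Fin k := ⟨0, by omega⟩
  ((canonicalRep k hk m).leftpad len zero).zip ((canonicalRep k hk n).leftpad len zero)

/-- A deterministic finite automaton with output, reading base-`base` digits. The states are
`0, …, numStates - 1`; the letters of the (finite) output alphabet are named by natural numbers. -/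
structure DFAO where
  base : ℕ
  two_le_base : 2 ≤ base
  numStates : ℕ
  start : Fin numStates
  step : Fin numStates → Fin base → Fin numStates
  output : Fin numStates → ℕ

namespace DFAO

/-- The automatic sequence generated by `M`: the output of the state that is reached from the
start state by reading the base-`base` representation of `n`. -/
def seq (M : DFAO) (n : ℕ) : ℕ :=
  M.output ((canonicalRep M.base M.two_le_base n).foldl M.step M.start)

/-- Finite descriptions of automata: base, start state, transition table, output table. -/
abbrev Code : Type := ℕ × ℕ × List (List ℕ) × List ℕ

/-- The description of `M`, with one row of the transition table for each state and one entry of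
that row for each digit. -/
def code (M : DFAO) : Code :=
  (M.base, (M.start : ℕ),
    List.ofFn (fun q => List.ofFn (fun d => (M.step q d : ℕ))), List.ofFn M.output)

end DFAO

/-- The factor of length `l` of the sequence `a` that begins at position `i`. -/
def factorAt {Δ : Type*} (a : ℕ → Δ) (i l : ℕ) : List Δ :=
  (List.range l).map (fun j => a (i + j))

/-- The word `x` occurs in `a` at position `i`. -/
def OccursAt {Δ : Type*} (a : ℕ → Δ) (x : List Δ) (i : ℕ) : Prop :=
  factorAt a i x.length = x

/-- `i < i'` are the positions of two consecutive occurrences of `x` in `a`. -/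
def ConsecutiveOccurrences {Δ : Type*} (a : ℕ → Δ) (x : List Δ) (i i' : ℕ) : Prop :=
  i < i' ∧ OccursAt a x i ∧ OccursAt a x i' ∧ ∀ t, i < t → t < i' → ¬ OccursAt a x t

/-- Every factor that occurs in `a` occurs infinitely often. -/
def IsRecurrentSeq {Δ : Type*} (a : ℕ → Δ) : Prop :=
  ∀ (x : List Δ) (i : ℕ), OccursAt a x i → {j | OccursAt a x j}.Infinite

/-- Any two consecutive occurrences of a nonempty factor `x` of `a` are at distance at most
`C` times the length of `x`. -/
def IsRecurrenceConstant {Δ : Type*} (a : ℕ → Δ) (C : ℝ) : Prop :=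
  ∀ x : List Δ, 1 ≤ x.length → ∀ i i' : ℕ, ConsecutiveOccurrences a x i i' →
    (i' : ℝ) - (i : ℝ) ≤ C * (x.length : ℝ)

/-- `a` is linearly recurrent. -/
def IsLinearlyRecurrent {Δ : Type*} (a : ℕ → Δ) : Prop :=
  ∃ C : ℝ, IsRecurrenceConstant a C

/-- The pairs `(n, l)` with `l ≥ 1` such that some occurrence of some factor of length `l` is
followed by the very next occurrence of that factor at distance `n`. -/
def gapPairs {Δ : Type*} (a : ℕ → Δ) : Set (ℕ × ℕ) :=
  {p | 1 ≤ p.2 ∧ ∃ i : ℕ, ConsecutiveOccurrences a (factorAt a i p.2) i (i + p.1)}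

/-- The language of the canonical base-`k` encodings of the pairs in `gapPairs a`. -/
def gapLanguage {Δ : Type*} (k : ℕ) (hk : 2 ≤ k) (a : ℕ → Δ) : Language (Fin k × Fin k) :=
  {w | ∃ p ∈ gapPairs a, w = canonicalPairRep k hk p.1 p.2}

/-! A digit determined map with finite codomain is a finite automaton presented by the right
congruence it induces on tuples of numbers; values and acceptance sets suffice, with no explicit
transition function. Such maps are closed under products, projection (subset construction) and
addition (track the outcome for both possible carries), so equality of factors, gaps, gap pairs and
returns are all recognised, with state counts computable from the number of states of the DFAO.

Pumping gives everything else. Deleting loops shows that existential searches can be bounded. For a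
bound `C` on the ratios, `exists_ratio` splits an accepted vector into a shorter accepted one plus a
multiple of a small vector `w`; since the loop repeats without limit, `w` obeys the ratio bound `C`
too. Hence the largest fraction below `C` with small entries already bounds all ratios. So the least
constant is one of finitely many fractions, and `exists_small_ratio_gt` makes each candidate
testable on bounded data. All searches are bounded and primitive recursive. Regularity is
Myhill–Nerode for the gap pair state. -/

/-- `f x` and a vector `e` of base-`k` digits determine `f (k • x + e)`: the map `f` can be computed
by an automaton that reads its arguments in parallel, most significant digits first. -/
def DigitDetermined (k : ℕ) {ι S : Type*} (f : (ι → ℕ) → S) : Prop :=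
  ∀ x y, f x = f y → ∀ e : ι → ℕ, (∀ i, e i < k) → f (k • x + e) = f (k • y + e)

theorem mul_add_lt_mul_add_iff {k c d : ℕ} (hc : c < k) (hd : d < k) (x y : ℕ) :
    k * x + c < k * y + d ↔ x < y ∨ (x ≤ y ∧ c < d) := by
  rcases lt_trichotomy x y with h | h | h
  · have : k * (x + 1) ≤ k * y := Nat.mul_le_mul_left k h
    have h2 : k * x + c < k * y + d := by rw [mul_add] at this; omega
    simp [h, h2]
  · subst h; simp
  · have : k * (y + 1) ≤ k * x := Nat.mul_le_mul_left k h
    rw [mul_add] at this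
    constructor
    · intro h'; omega
    · intro h'; omega

/-! ### Closure properties of digit determined maps -/

namespace DigitDetermined

variable {k : ℕ} {ι κ S T : Type*}

theorem prodMk {f : (ι → ℕ) → S} {g : (ι → ℕ) → T} (hf : DigitDetermined k f)
    (hg : DigitDetermined k g) : DigitDetermined k (fun v => (f v, g v)) := by
  intro x y h e he
  rw [Prod.mk.injEq] at h ⊢
  exact ⟨hf x y h.1 e he, hg x y h.2 e he⟩

theorem reindex {f : (ι → ℕ) → S} (hf : DigitDetermined k f) (r : ι → κ) :
    DigitDetermined k (fun v : κ → ℕ => f (v ∘ r)) :=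
  fun x y h e he => hf (x ∘ r) (y ∘ r) h (e ∘ r) fun i => he (r i)

/-- Projection along the first coordinate. -/
theorem range_cons (hk : 0 < k) {d : ℕ} {f : (Fin (d + 1) → ℕ) → S} (hf : DigitDetermined k f) :
    DigitDetermined k (fun v : Fin d → ℕ => Set.range fun t : ℕ => f (Fin.cons t v)) := by
  have key : ∀ x y : Fin d → ℕ,
      (Set.range fun t : ℕ => f (Fin.cons t x)) = (Set.range fun t : ℕ => f (Fin.cons t y)) →
      ∀ e : Fin d → ℕ, (∀ i, e i < k) →
      (Set.range fun t : ℕ => f (Fin.cons t (k • x + e))) ⊆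
        Set.range fun t : ℕ => f (Fin.cons t (k • y + e)) := by
    rintro x y h e he _ ⟨t, rfl⟩
    have split : ∀ (s c : ℕ) (z : Fin d → ℕ), (Fin.cons (k * s + c) (k • z + e) : Fin (d + 1) → ℕ) =
        k • (Fin.cons s z : Fin (d + 1) → ℕ) + Fin.cons c e := by
      intro s c z
      funext i
      refine Fin.cases ?_ (fun j => ?_) i <;> simp
    obtain ⟨s, hs⟩ : f (Fin.cons (t / k) x) ∈ Set.range fun t : ℕ => f (Fin.cons t y) := by
      rw [← h]; exact ⟨_, rfl⟩
    -- Keep the last digit of `t` and exchange its prefix `t / k` for `s`.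
    refine ⟨k * s + t % k, ?_⟩
    dsimp only at hs ⊢
    have ht := split (t / k) (t % k) x
    rw [Nat.div_add_mod] at ht
    rw [split, ht]
    refine hf _ _ hs _ fun i => ?_
    refine Fin.cases ?_ (fun j => ?_) i
    · simpa using Nat.mod_lt t hk
    · simpa using he j
  intro x y h e he
  exact Set.Subset.antisymm (key x y h e he) (key y x h.symm e he)

/-- Substitution of functions that produce a carry `c ≤ 1`. -/
theorem carry {f : (κ → ℕ) → S} (hf : DigitDetermined k f) (h : ℕ → (ι → ℕ) → κ → ℕ)
    (H : ∀ e : ι → ℕ, (∀ i, e i < k) → ∀ c ≤ 1, ∃ c' ≤ 1, ∃ r : κ → ℕ, (∀ j, r j < k) ∧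
      ∀ x, h c (k • x + e) = k • h c' x + r) :
    DigitDetermined k (fun v => (f (h 0 v), f (h 1 v))) := by
  intro x y hxy e he
  rw [Prod.mk.injEq] at hxy
  have main : ∀ c ≤ 1, f (h c (k • x + e)) = f (h c (k • y + e)) := by
    intro c hc
    obtain ⟨c', hc', r, hr, hh⟩ := H e he c hc
    rw [hh, hh]
    refine hf _ _ ?_ r hr
    interval_cases c'
    exacts [hxy.1, hxy.2]
  exact Prod.ext (main 0 zero_le_one) (main 1 le_rfl)

/-- Comparing after one more digit needs both `<` and `≤` of the prefixes, so the two are tracked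
together. -/
theorem lt_le (a b : ι) : DigitDetermined k (fun v : ι → ℕ => (v a < v b, v a ≤ v b)) := by
  intro x y h e he
  simp only [Prod.mk.injEq, eq_iff_iff] at h
  simp only [Pi.add_apply, Pi.smul_apply, smul_eq_mul, Prod.mk.injEq, eq_iff_iff]
  rw [← not_lt, ← not_lt (a := k * y b + e b), mul_add_lt_mul_add_iff (he a) (he b),
    mul_add_lt_mul_add_iff (he a) (he b), mul_add_lt_mul_add_iff (he b) (he a),
    mul_add_lt_mul_add_iff (he b) (he a)]
  omega

theorem eq_zero (hk : 0 < k) (a : ι) : DigitDetermined k (fun v : ι → ℕ => v a = 0) := by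
  intro x y h e _
  simp only [eq_iff_iff] at h
  simp [h, hk.ne']

/-- Truncation of a difference of two multiples to an interval. -/
theorem clamp (hk : 0 < k) (a b : ι) (p q M : ℕ) (hp : p ≤ M) (hq : q ≤ M) :
    DigitDetermined k
      (fun v : ι → ℕ => max (-M : ℤ) (min M ((q : ℤ) * v a - (p : ℤ) * v b))) := by
  -- A new digit contributes at most `(k - 1) * M` in absolute value, so a difference that has left
  -- the interval cannot return to its interior, and truncating early loses nothing.
  have key : ∀ (z d : ℤ), -((k : ℤ) - 1) * M ≤ d → d ≤ ((k : ℤ) - 1) * M →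
      max (-M : ℤ) (min M (k * z + d)) = max (-M : ℤ) (min M (k * max (-M : ℤ) (min M z) + d)) := by
    intro z d h1 h2
    have hk' : (1 : ℤ) ≤ k := by exact_mod_cast hk
    have hM : (0 : ℤ) ≤ M := by positivity
    rcases le_total z M with hz | hz
    · rcases le_total (-M : ℤ) z with hz' | hz'
      · rw [min_eq_right hz, max_eq_right hz']
      · rw [min_eq_right hz, max_eq_left hz']
        have h3 : (k : ℤ) * z ≤ k * (-M) := by gcongr
        have h4 : (k : ℤ) * z + d ≤ -M := by linarith
        have h5 : (k : ℤ) * (-M) + d ≤ -M := by linarith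
        rw [max_eq_left ((min_le_right _ _).trans h4), max_eq_left ((min_le_right _ _).trans h5)]
    · rw [min_eq_left hz, max_eq_right (by linarith : (-M : ℤ) ≤ M)]
      have h3 : (k : ℤ) * M ≤ k * z := by gcongr
      rw [min_eq_left (by linarith), min_eq_left (by linarith)]
  intro x y h e he
  have hd : ∀ z : ι → ℕ, (q : ℤ) * ((k • z + e) a : ℕ) - (p : ℤ) * ((k • z + e) b : ℕ) =
      k * ((q : ℤ) * z a - (p : ℤ) * z b) + ((q : ℤ) * e a - (p : ℤ) * e b) := by
    intro z
    simp only [Pi.add_apply, Pi.smul_apply, smul_eq_mul]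
    push_cast
    ring
  have bound : ∀ (r : ℕ) (i : ι), r ≤ M → (r : ℤ) * e i ≤ ((k : ℤ) - 1) * M := by
    intro r i hr
    have h1 : (e i : ℤ) ≤ (k : ℤ) - 1 := by have := he i; omega
    have h2 : (r : ℤ) ≤ M := by exact_mod_cast hr
    calc (r : ℤ) * e i ≤ M * ((k : ℤ) - 1) := by gcongr
      _ = _ := mul_comm _ _
  have h1 := bound q a hq
  have h2 := bound p b hp
  have h3 : (0 : ℤ) ≤ (q : ℤ) * e a := by positivity
  have h4 : (0 : ℤ) ≤ (p : ℤ) * e b := by positivity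
  dsimp only at h ⊢
  rw [hd, hd, key _ _ (by linarith) (by linarith), h, ← key _ _ (by linarith) (by linarith)]

/-! ### Pumping -/

theorem replace_prefix {f : (ι → ℕ) → S} (hf : DigitDetermined k f) (hk : 0 < k) {x y : ι → ℕ}
    (h : f x = f y) (m : ℕ) (s : ι → ℕ) (hs : ∀ i, s i < k ^ m) :
    f (k ^ m • x + s) = f (k ^ m • y + s) := by
  induction m generalizing s with
  | zero =>
    have : s = 0 := by funext i; simpa using hs i
    simpa [this] using h
  | succ m ih =>
    have h1 := hf _ _ (ih (fun i => s i / k) fun i => Nat.div_lt_of_lt_mul (by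
      rw [mul_comm, ← pow_succ]; exact hs i)) (fun i => s i % k) fun i => Nat.mod_lt _ hk
    have split : ∀ z : ι → ℕ, k ^ (m + 1) • z + s =
        k • (k ^ m • z + fun i => s i / k) + fun i => s i % k := by
      intro z
      funext i
      simp only [Pi.add_apply, Pi.smul_apply, smul_eq_mul]
      rw [mul_add, add_assoc, Nat.div_add_mod, pow_succ]
      ring
    rw [split, split]
    exact h1

theorem exists_lt_map_eq {N : ℕ} [Finite S] (hN : Nat.card S ≤ N) (g : ℕ → S) (m : ℕ) :
    ∃ a b, m ≤ a ∧ a < b ∧ b ≤ m + N ∧ g a = g b := by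
  have := Fintype.ofFinite S
  rw [Nat.card_eq_fintype_card] at hN
  obtain ⟨x, y, hxy, h⟩ := Fintype.exists_ne_map_eq_of_card_lt
    (fun i : Fin (N + 1) => g (m + i)) (by rw [Fintype.card_fin]; omega)
  have hxy' : (x : ℕ) ≠ y := fun h => hxy (Fin.ext h)
  rcases lt_or_gt_of_ne hxy' with hlt | hlt
  · exact ⟨m + x, m + y, by omega, by omega, by omega, h⟩
  · exact ⟨m + y, m + x, by omega, by omega, by omega, h.symm⟩

theorem smul_div_add_mod (n : ℕ) (v : ι → ℕ) :
    n • (fun i => v i / n) + (fun i => v i % n) = v := by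
  funext i
  simpa using Nat.div_add_mod (v i) n

/-- If the prefixes cut at positions `a` and `b` have the same state, the digits between these
positions can be removed. -/
theorem map_delete_block {f : (ι → ℕ) → S} (hf : DigitDetermined k f) (hk : 0 < k) {v : ι → ℕ}
    {a b : ℕ} (h : f (fun i => v i / k ^ a) = f (fun i => v i / k ^ b)) :
    f (k ^ a • (fun i => v i / k ^ b) + fun i => v i % k ^ a) = f v := by
  conv_rhs => rw [← smul_div_add_mod (k ^ a) v]
  exact hf.replace_prefix hk h.symm a _ fun i => Nat.mod_lt _ (by positivity)

/-- The pumping lemma for digit determined maps. -/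
theorem pump {f : (ι → ℕ) → S} (hf : DigitDetermined k f) (hk : 2 ≤ k) [Finite S] {N : ℕ}
    (hN : Nat.card S ≤ N) {v : ι → ℕ} {m : ℕ} (hm : N ≤ m) {c : ι} (hc : k ^ m ≤ v c)
    (hv : ∀ i, v i < k ^ (m + 1)) :
    ∃ (v' w : ι → ℕ) (K : ℕ), 0 < K ∧ v = v' + K • w ∧ w ≠ 0 ∧ (∀ i, w i < k ^ (N + 1)) ∧
      f v' = f v ∧ ∀ r : ℕ, ∃ g ≥ r, f (v' + g • w) = f v := by
  have hk0 : 0 < k := by omega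
  -- The repetition is sought among the leading digits, `a ≥ m - N`, so that the prefix `y`, and
  -- with it `w`, stays below `k ^ (N + 1)`.
  obtain ⟨a, b, ha, hab, hb, h⟩ := exists_lt_map_eq hN (fun e => f fun i => v i / k ^ e) (m - N)
  obtain ⟨d, rfl⟩ := Nat.exists_eq_add_of_lt hab
  rw [add_assoc] at hb h
  set d' := d + 1 with hd'
  set x : ι → ℕ := fun i => v i / k ^ (a + d') with hx
  set y : ι → ℕ := fun i => v i / k ^ a with hy
  set s : ι → ℕ := fun i => v i % k ^ a with hs
  have hxy : x = fun i => y i / k ^ d' := by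
    funext i
    simp only [hx, hy]
    rw [Nat.div_div_eq_div_mul, pow_add]
  have hkd : 2 ≤ k ^ d' := hk.trans (Nat.le_self_pow (by omega) k)
  have hvs : k ^ a • y + s = v := smul_div_add_mod _ _
  have hyz : k ^ d' • x + (fun i => y i % k ^ d') = y := by
    rw [hxy]; exact smul_div_add_mod _ _
  obtain ⟨w, hw⟩ : ∃ w, y = x + w := by
    refine ⟨fun i => y i - x i, ?_⟩
    funext i
    have : x i ≤ y i := by rw [hxy]; exact Nat.div_le_self _ _
    simp only [Pi.add_apply]
    omega
  have hfv : f (k ^ a • x + s) = f v := hf.map_delete_block hk0 h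
  have loop : ∀ r : ℕ, ∃ g ≥ r, f (x + g • w) = f x := by
    intro r
    induction r with
    | zero => exact ⟨0, le_rfl, by simp⟩
    | succ r ih =>
      obtain ⟨g, hg, hfg⟩ := ih
      -- Reading the loop block sends `x` to `x + w`, hence `x + g • w` to `x + (k ^ d' * g + 1) •
      -- w`.
      refine ⟨k ^ d' * g + 1, ?_, ?_⟩
      · have : g ≤ k ^ d' * g := Nat.le_mul_of_pos_left g (by omega)
        omega
      · have e1 : x + (k ^ d' * g + 1) • w =
            k ^ d' • (x + g • w) + (fun i => y i % k ^ d') := by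
          have : x + w = k ^ d' • x + (fun i => y i % k ^ d') := by rw [hyz, hw]
          rw [smul_add, add_right_comm, ← this, add_smul, one_smul, mul_smul]
          abel
        rw [e1, hf.replace_prefix hk0 hfg d' _ fun i => Nat.mod_lt _ (by positivity), hyz, h]
  refine ⟨k ^ a • x + s, w, k ^ a, by positivity, ?_, ?_, ?_, hfv, ?_⟩
  · rw [← hvs, hw, smul_add]; abel
  · rintro rfl
    have h1 : x c = y c := by rw [hw]; simp
    have h2 : 0 < y c := by
      refine Nat.div_pos (le_trans (Nat.pow_le_pow_right hk0 ?_) hc) (by positivity)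
      omega
    have h3 : y c / k ^ d' < y c := Nat.div_lt_self h2 (by omega)
    rw [hxy] at h1
    dsimp only at h1
    omega
  · intro i
    have h1 : w i ≤ y i := by rw [hw]; simp
    refine h1.trans_lt (Nat.div_lt_of_lt_mul ((hv i).trans_le ?_))
    rw [← pow_add]
    exact Nat.pow_le_pow_right hk0 (by omega)
  · intro r
    obtain ⟨g, hg, hfg⟩ := loop r
    refine ⟨k ^ a * g, hg.trans (Nat.le_mul_of_pos_left g (by positivity)), ?_⟩
    have := hf.replace_prefix hk0 hfg a s fun i => Nat.mod_lt _ (by positivity)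
    rw [hfv] at this
    rw [← this, smul_add, mul_smul]
    congr 1
    abel

theorem exists_leading [Finite ι] (hk : 2 ≤ k) {N : ℕ} {v : ι → ℕ} {j : ι} (hj : k ^ N ≤ v j) :
    ∃ m ≥ N, ∃ c, k ^ m ≤ v c ∧ ∀ i, v i < k ^ (m + 1) := by
  have : Nonempty ι := ⟨j⟩
  obtain ⟨c, hc⟩ := Finite.exists_max v
  have hpos : 0 < k ^ N := by positivity
  have hc0 : k ^ N ≤ v c := hj.trans (hc j)
  refine ⟨Nat.log k (v c), ?_, c, Nat.pow_log_le_self k (by omega), fun i =>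
    (hc i).trans_lt (Nat.lt_pow_succ_log_self (by omega) _)⟩
  exact Nat.le_log_of_pow_le (by omega) hc0

theorem exists_small [Fintype ι] {f : (ι → ℕ) → S} (hf : DigitDetermined k f) (hk : 2 ≤ k)
    [Finite S] {N : ℕ} (hN : Nat.card S ≤ N) (v : ι → ℕ) :
    ∃ v', f v' = f v ∧ ∀ i, v' i < k ^ (N + 1) := by
  induction hn : ∑ i, v i using Nat.strong_induction_on generalizing v with
  | _ n ih =>
    by_cases h : ∀ i, v i < k ^ (N + 1)
    · exact ⟨v, rfl, h⟩
    · push Not at h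
      obtain ⟨j, hj⟩ := h
      obtain ⟨m, hm, c, hc, hv⟩ := exists_leading hk hj
      obtain ⟨v', w, K, hK, hvw, hw, -, hfv, -⟩ := hf.pump hk hN (by omega : N ≤ m) hc hv
      obtain ⟨i, hi⟩ : ∃ i, w i ≠ 0 := by
        by_contra! h0
        exact hw (funext h0)
      have hlt : ∑ i, v' i < n := by
        rw [← hn, hvw]
        refine Finset.sum_lt_sum (fun i _ => by simp) ⟨i, Finset.mem_univ i, ?_⟩
        have : 0 < K * w i := Nat.mul_pos hK (Nat.pos_of_ne_zero hi)
        simpa using ⟨hK, Nat.pos_of_ne_zero hi⟩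
      obtain ⟨v'', h1, h2⟩ := ih _ hlt v' rfl
      exact ⟨v'', h1.trans hfv, h2⟩

/-- Only digit positions from `m` on are shortened; there all other coordinates have zeros, so they
do not change. -/
theorem exists_small_coord {f : (ι → ℕ) → S} (hf : DigitDetermined k f) (hk : 2 ≤ k)
    [Finite S] {N : ℕ} (hN : Nat.card S ≤ N) (c : ι) (m : ℕ) (v : ι → ℕ)
    (hm : ∀ j, j ≠ c → v j < k ^ m) :
    ∃ v', f v' = f v ∧ (∀ j, j ≠ c → v' j = v j) ∧ v' c < k ^ (m + N) := by
  have hk0 : 0 < k := by omega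
  induction hn : v c using Nat.strong_induction_on generalizing v with
  | _ n ih =>
    by_cases h : v c < k ^ (m + N)
    · exact ⟨v, rfl, fun _ _ => rfl, h⟩
    push Not at h
    obtain ⟨a, b, ha, hab, hb, he⟩ := exists_lt_map_eq hN (fun e => f fun i => v i / k ^ e) m
    have hpow : k ^ a < k ^ b := Nat.pow_lt_pow_right (by omega) hab
    have hfv := hf.map_delete_block hk0 he
    set v' : ι → ℕ := k ^ a • (fun i => v i / k ^ b) + fun i => v i % k ^ a with hv'
    have hother : ∀ j, j ≠ c → v' j = v j := by
      intro j hj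
      have h1 : v j < k ^ a := (hm j hj).trans_le (Nat.pow_le_pow_right hk0 ha)
      simp [hv', Nat.div_eq_of_lt (h1.trans hpow), Nat.mod_eq_of_lt h1]
    have hlt : v' c < n := by
      rw [← hn]
      conv_rhs => rw [← Nat.div_add_mod (v c) (k ^ a)]
      simp only [hv', Pi.add_apply, Pi.smul_apply, smul_eq_mul]
      gcongr
      obtain ⟨d, rfl⟩ := Nat.exists_eq_add_of_lt hab
      rw [add_assoc, pow_add, ← Nat.div_div_eq_div_mul]
      refine Nat.div_lt_self (Nat.div_pos (le_trans (Nat.pow_le_pow_right hk0 ?_) h)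
        (by positivity)) (Nat.one_lt_pow (by omega) (by omega))
      omega
    obtain ⟨v'', h1, h2, h3⟩ := ih _ hlt v' (fun j hj => by rw [hother j hj]; exact hm j hj) rfl
    exact ⟨v'', h1.trans hfv, fun j hj => (h2 j hj).trans (hother j hj), h3⟩

end DigitDetermined

/-! ### The automatic sequence as a digit determined map -/

theorem canonicalRep_zero (k : ℕ) (hk : 2 ≤ k) : canonicalRep k hk 0 = [] := by
  simp [canonicalRep]

theorem canonicalRep_mul_add (k : ℕ) (hk : 2 ≤ k) (x a : ℕ) (ha : a < k) (h : x ≠ 0 ∨ a ≠ 0) :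
    canonicalRep k hk (k * x + a) = canonicalRep k hk x ++ [⟨a, ha⟩] := by
  have hpos : 0 < k * x + a := by
    rcases h with h | h
    · have : 0 < k * x := Nat.mul_pos (by omega) (Nat.pos_of_ne_zero h)
      omega
    · omega
  have h1 : (k * x + a) % k = a := by rw [Nat.mul_add_mod, Nat.mod_eq_of_lt ha]
  have h2 : (k * x + a) / k = x := by
    rw [Nat.mul_add_div (by omega), Nat.div_eq_of_lt ha, add_zero]
  have h3 : Nat.digits k (k * x + a) = a :: Nat.digits k x := by
    rw [Nat.digits_def' (by omega) hpos, h1, h2]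
  simp only [canonicalRep]
  simp only [h3, List.pmap_cons, List.reverse_cons]

namespace DFAO

variable (M : DFAO)

/-- The state reached after reading `n`, where `none` stands for not having read anything. -/
def prefixState (n : ℕ) : Option (Fin M.numStates) :=
  if n = 0 then none else some ((canonicalRep M.base M.two_le_base n).foldl M.step M.start)

theorem prefixState_mul_add (x a : ℕ) (ha : a < M.base) (h : x ≠ 0 ∨ a ≠ 0) :
    M.prefixState (M.base * x + a) =
      some (M.step ((M.prefixState x).getD M.start) ⟨a, ha⟩) := by
  have hne : M.base * x + a ≠ 0 := by
    have := M.two_le_base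
    rcases h with h | h
    · have : 0 < M.base * x := Nat.mul_pos (by omega) (Nat.pos_of_ne_zero h)
      omega
    · omega
  rw [prefixState, if_neg hne, canonicalRep_mul_add _ _ _ _ ha h, List.foldl_append]
  by_cases hx : x = 0
  · simp [hx, canonicalRep_zero, prefixState]
  · simp [hx, prefixState]

theorem seq_eq (n : ℕ) : M.seq n = M.output ((M.prefixState n).getD M.start) := by
  by_cases h : n = 0
  · simp [seq, prefixState, h, canonicalRep_zero]
  · simp [seq, prefixState, h]

/-- The value `none` marks the number zero: leading zeros must be skipped, as the start state need
not be fixed by the digit `0`. -/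
theorem digitDetermined_prefixState :
    DigitDetermined M.base (fun v : Fin 1 → ℕ => M.prefixState (v 0)) := by
  intro x y h e he
  dsimp only at h
  have hzero : x 0 = 0 ↔ y 0 = 0 := by
    constructor <;> intro h0 <;> by_contra h1 <;> simp [prefixState, h0, h1] at h
  simp only [Pi.add_apply, Pi.smul_apply, smul_eq_mul]
  by_cases h0 : x 0 = 0 ∧ e 0 = 0
  · simp [h0.1, h0.2, hzero.1 h0.1]
  · rw [prefixState_mul_add _ _ _ (he 0) (by tauto), prefixState_mul_add _ _ _ (he 0) (by tauto), h]

end DFAO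

theorem exists_add_digits_eq {k a b c : ℕ} (ha : a < k) (hb : b < k) (hc : c ≤ 1) :
    ∃ c' ≤ 1, ∃ r < k, a + b + c = k * c' + r := by
  by_cases h : a + b + c < k
  · exact ⟨0, by omega, _, h, by omega⟩
  · exact ⟨1, le_rfl, a + b + c - k, by omega, by omega⟩

/-- Most significant digits come first, so the carry from later digits is unknown; the state keeps
the results for both carries. -/
theorem DigitDetermined.add_carry {k : ℕ} {ι S : Type*} {f : (Fin 1 → ℕ) → S}
    (hf : DigitDetermined k f) (a b : ι) :
    DigitDetermined k (fun v : ι → ℕ => (f ![v a + v b], f ![v a + v b + 1])) := by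
  refine hf.carry (fun c v => ![v a + v b + c]) fun e he c hc => ?_
  obtain ⟨c', hc', r, hr, h⟩ := exists_add_digits_eq (he a) (he b) hc
  refine ⟨c', hc', ![r], by simpa using hr, fun x => ?_⟩
  funext i
  fin_cases i
  simp only [Pi.add_apply, Pi.smul_apply, smul_eq_mul, Fin.zero_eta, Matrix.cons_val_zero]
  linear_combination h

theorem DigitDetermined.add_carry₃ {k : ℕ} {ι S : Type*} {f : (Fin 3 → ℕ) → S}
    (hf : DigitDetermined k f) (a b c : ι) :
    DigitDetermined k
      (fun v : ι → ℕ => (f ![v a, v a + v b, v c], f ![v a, v a + v b + 1, v c])) := by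
  refine hf.carry (fun t v => ![v a, v a + v b + t, v c]) fun e he t ht => ?_
  obtain ⟨t', ht', r, hr, h⟩ := exists_add_digits_eq (he a) (he b) ht
  refine ⟨t', ht', ![e a, r, e c], ?_, fun x => ?_⟩
  · intro j; fin_cases j <;> simp [hr, he]
  · funext i
    fin_cases i
    · simp
    · simp
      linear_combination h
    · simp

/-! ### Recognition of gaps and returns -/

/-- The factors of length `l` that begin at `i` and at `j` agree. -/
def FactorEq (a : ℕ → ℕ) (i j l : ℕ) : Prop := ∀ t < l, a (i + t) = a (j + t)

/-- The factor of length `l` that begins at `i` occurs next at the position `i + n`. -/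
def IsGapAt (a : ℕ → ℕ) (i n l : ℕ) : Prop :=
  0 < n ∧ FactorEq a i (i + n) l ∧ ∀ t < n, 0 < t → ¬ FactorEq a i (i + t) l

namespace DFAO

variable (M : DFAO)

theorem factorAt_eq_iff (i j l : ℕ) :
    factorAt M.seq j l = factorAt M.seq i l ↔ FactorEq M.seq i j l := by
  simp only [factorAt, List.map_inj_left, List.mem_range, FactorEq]
  exact forall₂_congr fun _ _ => eq_comm

theorem occursAt_factorAt_iff (i j l : ℕ) :
    OccursAt M.seq (factorAt M.seq i l) j ↔ FactorEq M.seq i j l := by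
  rw [OccursAt, ← factorAt_eq_iff]
  simp [factorAt]

theorem consecutiveOccurrences_iff (i n l : ℕ) :
    ConsecutiveOccurrences M.seq (factorAt M.seq i l) i (i + n) ↔ IsGapAt M.seq i n l := by
  simp only [ConsecutiveOccurrences, IsGapAt, occursAt_factorAt_iff]
  constructor
  · rintro ⟨h1, -, h2, h3⟩
    exact ⟨by omega, h2, fun t ht ht0 => h3 (i + t) (by omega) (by omega)⟩
  · rintro ⟨h1, h2, h3⟩
    refine ⟨by omega, fun _ _ => rfl, h2, fun t ht1 ht2 => ?_⟩
    obtain ⟨s, rfl⟩ := Nat.exists_eq_add_of_le ht1.le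
    exact h3 s (by omega) (by omega)

theorem mem_gapPairs_iff (n l : ℕ) :
    (n, l) ∈ gapPairs M.seq ↔ 0 < l ∧ ∃ i, IsGapAt M.seq i n l := by
  simp only [gapPairs, Set.mem_ofPred_eq, consecutiveOccurrences_iff]
  rfl

theorem isRecurrentSeq_iff :
    IsRecurrentSeq M.seq ↔ ∀ i l, ∃ j, i < j ∧ FactorEq M.seq i j l := by
  constructor
  · intro h i l
    have hx : OccursAt M.seq (factorAt M.seq i l) i :=
      (M.occursAt_factorAt_iff i i l).2 fun _ _ => rfl
    obtain ⟨j, hj, hij⟩ := (h _ i hx).exists_gt i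
    exact ⟨j, hij, (M.occursAt_factorAt_iff i j l).1 hj⟩
  · intro h x i hx
    refine Set.infinite_of_not_bddAbove ?_
    have step : ∀ j, OccursAt M.seq x j → ∃ j', j < j' ∧ OccursAt M.seq x j' := by
      intro j hj
      obtain ⟨j', h1, h2⟩ := h j x.length
      refine ⟨j', h1, ?_⟩
      rw [OccursAt] at hj ⊢
      rw [(M.factorAt_eq_iff j j' _).2 h2, hj]
    rintro ⟨b, hb⟩
    have key : ∀ r, ∃ j ≥ r, OccursAt M.seq x j := by
      intro r
      induction r with
      | zero => exact ⟨i, Nat.zero_le _, hx⟩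
      | succ r ih =>
        obtain ⟨j, h1, h2⟩ := ih
        obtain ⟨j', h3, h4⟩ := step j h2
        exact ⟨j', by omega, h4⟩
    obtain ⟨j, h1, h2⟩ := key (b + 1)
    have := hb h2
    omega

/-- States of an automaton that compares two factors. -/
abbrev FactorState (q : ℕ) : Type :=
  Set (((Option (Fin q) × Option (Fin q)) × (Option (Fin q) × Option (Fin q))) × (Prop × Prop))

/-- States of an automaton that recognizes the gaps after a given position. -/
abbrev GapState (q : ℕ) : Type :=
  ((FactorState q × FactorState q) × Prop) ×
    Set (((FactorState q × FactorState q) × (Prop × Prop)) × Prop)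

/-- States of an automaton that recognizes the gap pairs. -/
abbrev GapPairState (q : ℕ) : Type := Set (GapState q) × Prop

/-- States of an automaton that looks for later occurrences of a factor. -/
abbrev ReturnState (q : ℕ) : Type := Set (FactorState q × (Prop × Prop))

/-- Comparison of the factors of length `v 2` that begin at `v 0` and at `v 1`. -/
def factorState (v : Fin 3 → ℕ) : FactorState M.numStates :=
  Set.range fun t : ℕ => (fun u : Fin 4 → ℕ =>
    (((M.prefixState (u 1 + u 0), M.prefixState (u 1 + u 0 + 1)),
      (M.prefixState (u 2 + u 0), M.prefixState (u 2 + u 0 + 1))), (u 0 < u 3, u 0 ≤ u 3)))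
    (Fin.cons t v)

/-- The components with `+ 1` and `≤` play no role in acceptance; they only make the state
updatable. -/
theorem digitDetermined_factorState : DigitDetermined M.base M.factorState :=
  DigitDetermined.range_cons (by have := M.two_le_base; omega)
    (((M.digitDetermined_prefixState.add_carry (1 : Fin 4) 0).prodMk
      (M.digitDetermined_prefixState.add_carry (2 : Fin 4) 0)).prodMk (DigitDetermined.lt_le 0 3))

/-- The states in which the two factors agree. -/
def factorAccept : Set (FactorState M.numStates) :=
  {s | ∀ x ∈ s, x.2.1 → M.output (x.1.1.1.getD M.start) = M.output (x.1.2.1.getD M.start)}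

theorem factorState_mem_iff (i j l : ℕ) :
    M.factorState ![i, j, l] ∈ M.factorAccept ↔ FactorEq M.seq i j l := by
  constructor
  · intro h t ht
    rw [seq_eq, seq_eq]
    exact h _ ⟨t, rfl⟩ ht
  · rintro h _ ⟨t, rfl⟩ ht
    have := h t ht
    rw [seq_eq, seq_eq] at this
    exact this

/-- Recognition of the gap `v 1` of a factor of length `v 2` after the position `v 0`. -/
def gapState (v : Fin 3 → ℕ) : GapState M.numStates :=
  (((M.factorState ![v 0, v 0 + v 1, v 2], M.factorState ![v 0, v 0 + v 1 + 1, v 2]), v 1 = 0),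
    Set.range fun t : ℕ => (fun u : Fin 4 → ℕ =>
      (((M.factorState ![u 1, u 1 + u 0, u 3], M.factorState ![u 1, u 1 + u 0 + 1, u 3]),
        (u 0 < u 2, u 0 ≤ u 2)), u 0 = 0)) (Fin.cons t v))

theorem digitDetermined_gapState : DigitDetermined M.base M.gapState := by
  have hk : 0 < M.base := by have := M.two_le_base; omega
  exact ((M.digitDetermined_factorState.add_carry₃ (0 : Fin 3) 1 2).prodMk
    (DigitDetermined.eq_zero hk 1)).prodMk (DigitDetermined.range_cons hk
      (((M.digitDetermined_factorState.add_carry₃ (1 : Fin 4) 0 3).prodMk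
        (DigitDetermined.lt_le 0 2)).prodMk (DigitDetermined.eq_zero hk 0)))

def gapAccept : Set (GapState M.numStates) :=
  {s | ¬ s.1.2 ∧ s.1.1.1 ∈ M.factorAccept ∧
    ∀ x ∈ s.2, x.1.2.1 → ¬ x.2 → x.1.1.1 ∉ M.factorAccept}

theorem gapState_mem_iff (i n l : ℕ) :
    M.gapState ![i, n, l] ∈ M.gapAccept ↔ IsGapAt M.seq i n l := by
  simp only [IsGapAt, ← factorState_mem_iff, Nat.pos_iff_ne_zero]
  constructor
  · rintro ⟨h1, h2, h3⟩
    exact ⟨h1, h2, fun t ht ht0 => h3 _ ⟨t, rfl⟩ ht ht0⟩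
  · rintro ⟨h1, h2, h3⟩
    refine ⟨h1, h2, ?_⟩
    rintro _ ⟨t, rfl⟩ ht ht0
    exact h3 t ht ht0

/-- Recognition of the gap pair `(v 0, v 1)`. -/
def gapPairState (v : Fin 2 → ℕ) : GapPairState M.numStates :=
  (Set.range fun t : ℕ => M.gapState (Fin.cons t v), v 1 = 0)

theorem digitDetermined_gapPairState : DigitDetermined M.base M.gapPairState := by
  have hk : 0 < M.base := by have := M.two_le_base; omega
  exact (DigitDetermined.range_cons hk M.digitDetermined_gapState).prodMk
    (DigitDetermined.eq_zero hk 1)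

def gapPairAccept : Set (GapPairState M.numStates) :=
  {s | ¬ s.2 ∧ ∃ x ∈ s.1, x ∈ M.gapAccept}

theorem gapPairState_mem_iff (n l : ℕ) :
    M.gapPairState ![n, l] ∈ M.gapPairAccept ↔ (n, l) ∈ gapPairs M.seq := by
  rw [mem_gapPairs_iff]
  simp only [← gapState_mem_iff, Nat.pos_iff_ne_zero]
  constructor
  · rintro ⟨h1, _, ⟨t, rfl⟩, h2⟩
    exact ⟨h1, t, h2⟩
  · rintro ⟨h1, t, h2⟩
    exact ⟨h1, _, ⟨t, rfl⟩, h2⟩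

/-- The occurrences of the factor of length `v 1` that begins at `v 0`. -/
def returnState (v : Fin 2 → ℕ) : ReturnState M.numStates :=
  Set.range fun t : ℕ => (fun u : Fin 3 → ℕ =>
    (M.factorState (u ∘ ![1, 0, 2]), (u 1 < u 0, u 1 ≤ u 0))) (Fin.cons t v)

theorem digitDetermined_returnState : DigitDetermined M.base M.returnState :=
  DigitDetermined.range_cons (by have := M.two_le_base; omega)
    ((M.digitDetermined_factorState.reindex ![1, 0, 2]).prodMk (DigitDetermined.lt_le 1 0))

def returnAccept : Set (ReturnState M.numStates) :=
  {s | ∃ x ∈ s, x.2.1 ∧ x.1 ∈ M.factorAccept}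

theorem returnState_mem_iff (i l : ℕ) :
    M.returnState ![i, l] ∈ M.returnAccept ↔ ∃ j, i < j ∧ FactorEq M.seq i j l := by
  simp only [← factorState_mem_iff]
  have hv : ∀ t : ℕ, (Fin.cons t ![i, l] : Fin 3 → ℕ) ∘ ![1, 0, 2] = ![i, t, l] := by
    intro t
    funext j
    fin_cases j <;> rfl
  simp only [← hv]
  constructor
  · rintro ⟨_, ⟨t, rfl⟩, h1, h2⟩
    exact ⟨t, h1, h2⟩
  · rintro ⟨t, h1, h2⟩
    exact ⟨_, ⟨t, rfl⟩, h1, h2⟩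

end DFAO

/-! ### State counts -/

/-- The number of states for comparing two factors of a sequence with `q` states. -/
def factorStates (q : ℕ) : ℕ := 2 ^ (((q + 1) * (q + 1)) * ((q + 1) * (q + 1)) * (2 * 2))

def gapStates (q : ℕ) : ℕ :=
  factorStates q * factorStates q * 2 * 2 ^ (factorStates q * factorStates q * (2 * 2) * 2)

def gapPairStates (q : ℕ) : ℕ := 2 ^ gapStates q * 2

def returnStates (q : ℕ) : ℕ := 2 ^ (factorStates q * (2 * 2))

theorem Nat.card_set_eq (α : Type*) [Finite α] : Nat.card (Set α) = 2 ^ Nat.card α := by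
  have := Fintype.ofFinite α
  simp

theorem Nat.card_prop : Nat.card Prop = 2 := by simp

theorem card_factorState (q : ℕ) : Nat.card (DFAO.FactorState q) = factorStates q := by
  rw [Nat.card_set_eq]
  simp only [Nat.card_prod, Nat.card_prop, Finite.card_option, Nat.card_fin, factorStates]

theorem card_gapState (q : ℕ) : Nat.card (DFAO.GapState q) = gapStates q := by
  rw [Nat.card_prod, Nat.card_set_eq]
  simp only [Nat.card_prod, Nat.card_prop, card_factorState, gapStates]

theorem card_gapPairState (q : ℕ) : Nat.card (DFAO.GapPairState q) = gapPairStates q := by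
  rw [Nat.card_prod, Nat.card_set_eq, card_gapState, Nat.card_prop, gapPairStates]

theorem card_returnState (q : ℕ) : Nat.card (DFAO.ReturnState q) = returnStates q := by
  rw [Nat.card_set_eq]
  simp only [Nat.card_prod, Nat.card_prop, card_factorState, returnStates]

/-! ### Suprema of ratios -/

namespace DigitDetermined

variable {k : ℕ} {ι S T : Type*}

theorem of_injective_comp {f : (ι → ℕ) → S} {φ : S → T} (hφ : Function.Injective φ)
    (h : DigitDetermined k (fun v => φ (f v))) : DigitDetermined k f :=
  fun x y hxy e he => hφ (h x y (congrArg φ hxy) e he)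

/-- If the ratios `v 0 / v 1` are bounded on a set recognized by a digit determined map, then they
have a least upper bound whose numerator and denominator are small. -/
theorem exists_ratio {f : (Fin 2 → ℕ) → S} (hf : DigitDetermined k f) (hk : 2 ≤ k) [Finite S]
    {N : ℕ} (hN : Nat.card S ≤ N) {A : Set S} (hpos : ∀ v, f v ∈ A → 0 < v 1)
    (hne : ∃ v, f v ∈ A) {C : ℝ} (hC : ∀ v, f v ∈ A → (v 0 : ℝ) ≤ C * v 1) :
    ∃ p < k ^ (N + 1), ∃ q < k ^ (N + 1), 0 < q ∧ (p : ℝ) ≤ C * q ∧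
      ∀ v, f v ∈ A → q * v 0 ≤ p * v 1 := by
  classical
  set B := k ^ (N + 1) with hB
  -- Candidates need not be accepted by `f`, because the loop vector `w` used below need not be.
  let D : Finset (ℕ × ℕ) := (Finset.range B ×ˢ Finset.range B).filter
    fun x => 0 < x.2 ∧ (x.1 : ℝ) ≤ C * x.2
  have memD : ∀ v : Fin 2 → ℕ, (∀ i, v i < B) → 0 < v 1 → (v 0 : ℝ) ≤ C * v 1 →
      (v 0, v 1) ∈ D := by
    intro v h1 h2 h3
    simp only [D, Finset.mem_filter, Finset.mem_product, Finset.mem_range]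
    exact ⟨⟨h1 0, h1 1⟩, h2, h3⟩
  obtain ⟨v₀, hv₀⟩ := hne
  obtain ⟨v₁, hv₁, hsmall⟩ := hf.exists_small hk hN v₀
  have hv₁A : f v₁ ∈ A := hv₁ ▸ hv₀
  obtain ⟨⟨p, q⟩, hpq, hmax⟩ := D.exists_max_image (fun x => (x.1 : ℚ) / x.2)
    ⟨_, memD v₁ hsmall (hpos _ hv₁A) (hC _ hv₁A)⟩
  simp only [D, Finset.mem_filter, Finset.mem_product, Finset.mem_range] at hpq
  obtain ⟨⟨hp, hq⟩, hq0, hpC⟩ := hpq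
  have hle : ∀ v : Fin 2 → ℕ, (∀ i, v i < B) → 0 < v 1 → (v 0 : ℝ) ≤ C * v 1 →
      q * v 0 ≤ p * v 1 := by
    intro v h1 h2 h3
    have := hmax _ (memD v h1 h2 h3)
    dsimp only at this
    rw [div_le_div_iff₀ (by exact_mod_cast h2) (by exact_mod_cast hq0)] at this
    rw [mul_comm q]
    exact_mod_cast this
  refine ⟨p, hp, q, hq, hq0, hpC, fun v hv => ?_⟩
  induction hn : v 0 + v 1 using Nat.strong_induction_on generalizing v with
  | _ n ih =>
    by_cases h : ∀ i, v i < B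
    · exact hle v h (hpos v hv) (hC v hv)
    push Not at h
    obtain ⟨j, hj⟩ := h
    obtain ⟨m, hm, c, hc, hvm⟩ := exists_leading hk hj
    obtain ⟨v', w, K, hK, hvw, hw, hwB, hfv, hloop⟩ :=
      hf.pump hk hN (by omega : N ≤ m) hc hvm
    have hv'A : f v' ∈ A := hfv ▸ hv
    -- Otherwise each repetition gains at least `δ`, and enough of them violate the bound `C`.
    have hratio : (w 0 : ℝ) ≤ C * w 1 := by
      by_contra! hlt
      set δ := (w 0 : ℝ) - C * w 1 with hδ
      have hδ0 : 0 < δ := by linarith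
      obtain ⟨r, hr⟩ := exists_nat_gt ((C * v' 1 - v' 0) / δ)
      obtain ⟨g, hg, hfg⟩ := hloop r
      have h1 := hC _ (hfg ▸ hv : f (v' + g • w) ∈ A)
      simp only [Pi.add_apply, Pi.smul_apply, smul_eq_mul] at h1
      push_cast at h1
      rw [div_lt_iff₀ hδ0] at hr
      have hg' : (r : ℝ) ≤ g := by exact_mod_cast hg
      have h2 : (r : ℝ) * δ ≤ g * δ := by gcongr
      have h3 : (g : ℝ) * δ = g * w 0 - C * (g * w 1) := by rw [hδ]; ring
      linarith
    have hw1 : 0 < w 1 := by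
      by_contra! h0
      have h1 : w 1 = 0 := by omega
      rw [h1] at hratio
      have h2 : w 0 = 0 := by
        have : (w 0 : ℝ) ≤ 0 := by simpa using hratio
        exact_mod_cast le_antisymm this (Nat.cast_nonneg _)
      apply hw
      funext i
      fin_cases i
      exacts [h2, h1]
    have e0 : v 0 = v' 0 + K * w 0 := by rw [hvw]; simp
    have e1 : v 1 = v' 1 + K * w 1 := by rw [hvw]; simp
    have hKw : 0 < K * w 1 := Nat.mul_pos hK hw1
    have i1 := ih (v' 0 + v' 1) (by omega) v' hv'A rfl
    have i2 := Nat.mul_le_mul_left K (hle w hwB hw1 hratio)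
    rw [e0, e1]
    calc q * (v' 0 + K * w 0) = q * v' 0 + K * (q * w 0) := by ring
      _ ≤ p * v' 1 + K * (p * w 1) := Nat.add_le_add i1 i2
      _ = _ := by ring

/-- A ratio greater than `p / q` is already found among small vectors. -/
theorem exists_small_ratio_gt {f : (Fin 2 → ℕ) → S} (hf : DigitDetermined k f) (hk : 2 ≤ k)
    [Finite S] {N : ℕ} (hN : Nat.card S ≤ N) {A : Set S} {p q B : ℕ} (hp : p < B) (hq : q < B)
    {v : Fin 2 → ℕ} (hv : f v ∈ A) (h : p * v 1 < q * v 0) :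
    ∃ v', f v' ∈ A ∧ p * v' 1 < q * v' 0 ∧ ∀ i, v' i < k ^ (N * (2 * B + 1) + 1) := by
  -- Truncation keeps the sign of `q * v 0 - p * v 1` and adds a factor of only `2 * B + 1` to the
  -- state count.
  let φ : (Fin 2 → ℕ) → Set.Icc (-B : ℤ) B := fun v =>
    ⟨max (-B : ℤ) (min B ((q : ℤ) * v 0 - (p : ℤ) * v 1)), le_max_left _ _,
      max_le (by omega) (min_le_left _ _)⟩
  have hφ : DigitDetermined k φ :=
    of_injective_comp Subtype.val_injective (clamp (by omega) 0 1 p q B hp.le hq.le)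
  have hiff : ∀ v, 0 < (φ v).1 ↔ p * v 1 < q * v 0 := by
    intro v
    simp only [φ, lt_max_iff, lt_min_iff, sub_pos]
    constructor
    · rintro (h | h)
      · omega
      · exact_mod_cast h.2
    · intro h
      exact Or.inr ⟨by omega, by exact_mod_cast h⟩
  have hcard : Nat.card (S × Set.Icc (-B : ℤ) B) ≤ N * (2 * B + 1) := by
    rw [Nat.card_prod]
    refine Nat.mul_le_mul hN ?_
    rw [Nat.card_eq_fintype_card, Fintype.card_ofFinset, Int.card_Icc]
    omega
  obtain ⟨v', h1, h2⟩ := (hf.prodMk hφ).exists_small hk hcard v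
  rw [Prod.mk.injEq] at h1
  refine ⟨v', h1.1 ▸ hv, ?_, h2⟩
  rw [← hiff, h1.2, hiff]
  exact h

end DigitDetermined

/-! ### Reduction to bounded searches -/

theorem le_pow_add_left {k : ℕ} (hk : 2 ≤ k) (a b : ℕ) : a < k ^ (a + b) :=
  (Nat.lt_pow_self (by omega)).trans_le (Nat.pow_le_pow_right (by omega) (by omega))

theorem lt_pow_add_right {k : ℕ} (hk : 2 ≤ k) (a b : ℕ) : b < k ^ (a + b) :=
  (Nat.lt_pow_self (by omega)).trans_le (Nat.pow_le_pow_right (by omega) (by omega))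

/-- A bound for numerator and denominator of the least recurrence constant. -/
def ratioBound (k q : ℕ) : ℕ := k ^ (gapPairStates q + 1)

/-- A bound for the gap pairs that have to be examined. -/
def gapPairBound (k q : ℕ) : ℕ := k ^ (gapPairStates q * (2 * ratioBound k q + 1) + 1)

/-- A bound for the factors that have to be examined for recurrence. -/
def factorBound (k q : ℕ) : ℕ := k ^ (returnStates q + 1)

namespace DFAO

variable (M : DFAO)

theorem exists_isGapAt_iff (n l : ℕ) :
    (∃ i, IsGapAt M.seq i n l) ↔
      ∃ i < M.base ^ (n + l + gapStates M.numStates), IsGapAt M.seq i n l := by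
  refine ⟨fun ⟨i, hi⟩ => ?_, fun ⟨i, _, hi⟩ => ⟨i, hi⟩⟩
  obtain ⟨v, h1, h2, h3⟩ := M.digitDetermined_gapState.exists_small_coord M.two_le_base
    (card_gapState _).le 0 (n + l) ![i, n, l] (by
      intro j hj
      fin_cases j
      · exact absurd rfl hj
      · exact le_pow_add_left M.two_le_base n l
      · exact lt_pow_add_right M.two_le_base n l)
  have hv : v = ![v 0, n, l] := by
    funext j
    fin_cases j
    exacts [rfl, h2 1 (by decide), h2 2 (by decide)]
  refine ⟨v 0, h3, ?_⟩
  rw [← gapState_mem_iff, ← hv, h1, gapState_mem_iff]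
  exact hi

theorem exists_return_iff (i l : ℕ) :
    (∃ j, i < j ∧ FactorEq M.seq i j l) ↔
      ∃ j < M.base ^ (i + l + returnStates M.numStates), i < j ∧ FactorEq M.seq i j l := by
  refine ⟨fun ⟨j, hj⟩ => ?_, fun ⟨j, _, hj⟩ => ⟨j, hj⟩⟩
  let f : (Fin 3 → ℕ) → FactorState M.numStates × (Prop × Prop) := fun u =>
    (M.factorState (u ∘ ![0, 1, 2]), (u 0 < u 1, u 0 ≤ u 1))
  have hf : DigitDetermined M.base f :=
    (M.digitDetermined_factorState.reindex ![0, 1, 2]).prodMk (DigitDetermined.lt_le 0 1)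
  have hcard : Nat.card (FactorState M.numStates × (Prop × Prop)) ≤ returnStates M.numStates := by
    simp only [Nat.card_prod, Nat.card_prop, card_factorState, returnStates]
    exact Nat.lt_two_pow_self.le
  have hid : ∀ u : Fin 3 → ℕ, u ∘ ![0, 1, 2] = ![u 0, u 1, u 2] := by
    intro u
    funext j
    fin_cases j <;> rfl
  obtain ⟨v, h1, h2, h3⟩ := hf.exists_small_coord M.two_le_base hcard 1 (i + l) ![i, j, l] (by
      intro c hc
      fin_cases c
      · exact le_pow_add_left M.two_le_base i l
      · exact absurd rfl hc
      · exact lt_pow_add_right M.two_le_base i l)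
  have h0 : v 0 = i := h2 0 (by decide)
  have h4 : v 2 = l := h2 2 (by decide)
  simp only [f, hid, h0, h4, Prod.mk.injEq, eq_iff_iff] at h1
  refine ⟨v 1, h3, h1.2.1.2 hj.1, ?_⟩
  rw [← factorState_mem_iff, h1.1]
  exact (M.factorState_mem_iff i j l).2 hj.2

theorem isRecurrentSeq_iff_bounded :
    IsRecurrentSeq M.seq ↔ ∀ i < factorBound M.base M.numStates,
      ∀ l < factorBound M.base M.numStates,
        ∃ j < M.base ^ (i + l + returnStates M.numStates), i < j ∧ FactorEq M.seq i j l := by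
  simp only [← exists_return_iff, isRecurrentSeq_iff]
  refine ⟨fun h i _ l _ => h i l, fun h i l => ?_⟩
  obtain ⟨v, h1, h2⟩ := M.digitDetermined_returnState.exists_small M.two_le_base
    (card_returnState _).le ![i, l]
  have hv : v = ![v 0, v 1] := by
    funext j
    fin_cases j <;> rfl
  rw [← returnState_mem_iff, ← h1, hv, returnState_mem_iff]
  exact h _ (h2 0) _ (h2 1)

theorem isRecurrenceConstant_iff (C : ℝ) :
    IsRecurrenceConstant M.seq C ↔ ∀ p ∈ gapPairs M.seq, (p.1 : ℝ) ≤ C * p.2 := by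
  constructor
  · rintro h ⟨n, l⟩ ⟨hl, i, hi⟩
    have hlen : (factorAt M.seq i l).length = l := by simp [factorAt]
    have := h _ (by rw [hlen]; exact hl) i (i + n) hi
    rw [hlen] at this
    push_cast at this
    simpa using this
  · intro h x hx i i' hii
    obtain ⟨n, rfl⟩ := Nat.exists_eq_add_of_le hii.1.le
    have hxi : factorAt M.seq i x.length = x := hii.2.1
    have := h (n, x.length) ⟨hx, i, by rw [hxi]; exact hii⟩
    push_cast
    simpa using this

/-- Some letter repeats, by pigeonhole; the least return distance from a suitable position is a gap.
Without gaps every real would be a recurrence constant. -/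
theorem gapPairs_nonempty : (gapPairs M.seq).Nonempty := by
  have : Finite (Set.range M.seq) := by
    refine (Set.Finite.subset (Set.finite_range M.output) ?_).to_subtype
    rintro _ ⟨n, rfl⟩
    exact ⟨_, rfl⟩
  obtain ⟨x, y, hxy, h⟩ := Finite.exists_ne_map_eq_of_infinite (Set.rangeFactorization M.seq)
  have h : M.seq x = M.seq y := congrArg Subtype.val h
  have key : ∃ i n, 0 < n ∧ M.seq i = M.seq (i + n) := by
    rcases lt_or_gt_of_ne hxy with hlt | hlt
    · exact ⟨x, y - x, by omega, by rw [h]; congr 1; omega⟩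
    · exact ⟨y, x - y, by omega, by rw [← h]; congr 1; omega⟩
  obtain ⟨i, hi⟩ := key
  classical
  refine ⟨(Nat.find hi, 1), (M.mem_gapPairs_iff _ _).2 ⟨one_pos, i, (Nat.find_spec hi).1, ?_, ?_⟩⟩
  · intro t ht
    obtain rfl : t = 0 := by omega
    exact (Nat.find_spec hi).2
  · intro t ht ht0 heq
    exact Nat.find_min hi ht ⟨ht0, heq 0 one_pos⟩

theorem exists_ratio_of_isRecurrenceConstant {C : ℝ} (hC : IsRecurrenceConstant M.seq C) :
    ∃ p < ratioBound M.base M.numStates, ∃ q < ratioBound M.base M.numStates,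
      0 < q ∧ (p : ℝ) ≤ C * q ∧ ∀ n l, (n, l) ∈ gapPairs M.seq → q * n ≤ p * l := by
  rw [isRecurrenceConstant_iff] at hC
  have hvec : ∀ v : Fin 2 → ℕ, M.gapPairState v ∈ M.gapPairAccept ↔
      (v 0, v 1) ∈ gapPairs M.seq := by
    intro v
    rw [← gapPairState_mem_iff]
    have : v = ![v 0, v 1] := by
      funext j
      fin_cases j <;> rfl
    rw [← this]
  obtain ⟨⟨n₀, l₀⟩, hne⟩ := M.gapPairs_nonempty
  obtain ⟨p, hp, q, hq, hq0, hpC, h⟩ := M.digitDetermined_gapPairState.exists_ratio M.two_le_base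
    (card_gapPairState _).le (A := M.gapPairAccept) (C := C) (fun v hv => ((hvec v).1 hv).1)
    ⟨![n₀, l₀], (M.gapPairState_mem_iff _ _).2 hne⟩ (fun v hv => hC _ ((hvec v).1 hv))
  exact ⟨p, hp, q, hq, hq0, hpC, fun n l hnl => h ![n, l] ((M.gapPairState_mem_iff _ _).2 hnl)⟩

/-- A violation of the ratio bound can be pumped down to one with small `n`, `l`, and then to a
small position `i`. -/
theorem ratio_le_iff_bounded {p q : ℕ} (hp : p < ratioBound M.base M.numStates)
    (hq : q < ratioBound M.base M.numStates) :
    (∀ n l, (n, l) ∈ gapPairs M.seq → q * n ≤ p * l) ↔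
      ∀ n < gapPairBound M.base M.numStates, ∀ l < gapPairBound M.base M.numStates, 0 < l →
        ∀ i < M.base ^ (n + l + gapStates M.numStates), IsGapAt M.seq i n l → q * n ≤ p * l := by
  constructor
  · intro h n _ l _ hl i _ hi
    exact h n l ((M.mem_gapPairs_iff n l).2 ⟨hl, i, hi⟩)
  · intro h n l hnl
    by_contra! hlt
    obtain ⟨v, h1, h2, h3⟩ := M.digitDetermined_gapPairState.exists_small_ratio_gt M.two_le_base
      (card_gapPairState _).le hp hq (v := ![n, l]) ((M.gapPairState_mem_iff _ _).2 hnl) hlt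
    have hv : v = ![v 0, v 1] := by
      funext j
      fin_cases j <;> rfl
    rw [hv, gapPairState_mem_iff, mem_gapPairs_iff, exists_isGapAt_iff] at h1
    obtain ⟨h4, i, hi, h5⟩ := h1
    exact absurd (h _ (h3 0) _ (h3 1) h4 i hi h5) (by omega)

end DFAO

/-! ### Primitive recursive decision procedures on codes -/

namespace PrimrecPred

variable {α : Type*} [Primcodable α]

theorem imp {p q : α → Prop} (hp : PrimrecPred p) (hq : PrimrecPred q) :
    PrimrecPred fun a => p a → q a := by
  classical
  exact (hp.not.or hq).of_eq fun a => imp_iff_not_or.symm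

theorem exists_lt_of_primrec {R : α → ℕ → Prop} {f : α → ℕ}
    (hR : PrimrecPred fun x : α × ℕ => R x.1 x.2) (hf : Primrec f) :
    PrimrecPred fun a => ∃ x < f a, R a x := by
  have h : PrimrecRel fun (x : ℕ) (a : α) => R a x :=
    PrimrecPred.comp (f := fun y : ℕ × α => (y.2, y.1)) hR (Primrec.snd.pair Primrec.fst)
  exact (h.exists_mem_list.comp (Primrec.list_range.comp hf) Primrec.id).of_eq fun a => by simp

theorem forall_lt_of_primrec {R : α → ℕ → Prop} {f : α → ℕ}
    (hR : PrimrecPred fun x : α × ℕ => R x.1 x.2) (hf : Primrec f) :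
    PrimrecPred fun a => ∀ x < f a, R a x := by
  have h : PrimrecRel fun (x : ℕ) (a : α) => R a x :=
    PrimrecPred.comp (f := fun y : ℕ × α => (y.2, y.1)) hR (Primrec.snd.pair Primrec.fst)
  exact (h.forall_mem_list.comp (Primrec.list_range.comp hf) Primrec.id).of_eq fun a => by simp

end PrimrecPred

theorem Primrec.nat_pow : Primrec₂ ((· ^ ·) : ℕ → ℕ → ℕ) :=
  Primrec₂.unpaired'.1 Nat.Primrec.pow

namespace DFAO

/-- The state reached after reading `n` in the automaton described by `c`. -/
def codeState (c : Code) (n : ℕ) : ℕ :=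
  if n = 0 then c.2.1
  -- `max c.1 2` forces termination on arbitrary codes; for the code of a DFAO it is the base.
  else (c.2.2.1.getD (codeState c (n / max c.1 2)) []).getD (n % max c.1 2) 0
termination_by n
decreasing_by exact Nat.div_lt_self (by omega) (by omega)

/-- The sequence generated by the automaton described by `c`. -/
def codeSeq (c : Code) (n : ℕ) : ℕ := c.2.2.2.getD (codeState c n) 0

theorem codeState_code (M : DFAO) (n : ℕ) :
    codeState M.code n = ((M.prefixState n).getD M.start : Fin M.numStates) := by
  have hk := M.two_le_base
  induction n using Nat.strong_induction_on with
  | _ n ih =>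
    rw [codeState]
    by_cases h : n = 0
    · simp [h, code, prefixState]
    · have hmax : max M.code.1 2 = M.base := max_eq_left hk
      have hmod : n % M.base < M.base := Nat.mod_lt _ (by omega)
      rw [if_neg h, hmax, ih _ (Nat.div_lt_self (by omega) (by omega))]
      have hsplit := M.prefixState_mul_add (n / M.base) (n % M.base) hmod (by
        by_contra! h0
        have := Nat.div_add_mod n M.base
        rw [h0.1, h0.2] at this
        omega)
      rw [Nat.div_add_mod] at hsplit
      rw [hsplit]
      simp [code, List.getD_eq_getElem?_getD, hmod]

theorem codeSeq_code (M : DFAO) : codeSeq M.code = M.seq := by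
  funext n
  rw [codeSeq, codeState_code, seq_eq]
  simp [code, List.getD_eq_getElem?_getD]

/-- The number of states of the automaton described by `c`. -/
def codeSize (c : Code) : ℕ := c.2.2.2.length

theorem codeSize_code (M : DFAO) : codeSize M.code = M.numStates := by
  simp [codeSize, code]

/-- Decidable form of the statement that no gap is longer than `p / q` times the factor. -/
def CodeRatioLe (c : Code) (p q : ℕ) : Prop :=
  ∀ n < gapPairBound c.1 (codeSize c), ∀ l < gapPairBound c.1 (codeSize c), 0 < l →
    ∀ i < c.1 ^ (n + l + gapStates (codeSize c)), IsGapAt (codeSeq c) i n l → q * n ≤ p * l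

def CodeLinearlyRecurrent (c : Code) : Prop :=
  ∃ p < ratioBound c.1 (codeSize c), ∃ q < ratioBound c.1 (codeSize c),
    0 < q ∧ CodeRatioLe c p q

def CodeRecurrent (c : Code) : Prop :=
  ∀ i < factorBound c.1 (codeSize c), ∀ l < factorBound c.1 (codeSize c),
    ∃ j < c.1 ^ (i + l + returnStates (codeSize c)), i < j ∧ FactorEq (codeSeq c) i j l

def CodeOptimal (c : Code) (p q : ℕ) : Prop :=
  (p < ratioBound c.1 (codeSize c) ∧ q < ratioBound c.1 (codeSize c)) ∧
  (0 < q ∧ CodeRatioLe c p q) ∧ ∀ p' < ratioBound c.1 (codeSize c),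
    ∀ q' < ratioBound c.1 (codeSize c), 0 < q' → CodeRatioLe c p' q' → p * q' ≤ p' * q

section Primrec

open Primrec

theorem primrec_codeState : Primrec₂ codeState := by
  -- Course-of-values recursion: `L` lists the earlier states, so its length is the current
  -- argument.
  refine nat_strong_rec codeState (g := fun c L =>
    if L.length = 0 then some c.2.1
    else some ((c.2.2.1.getD (L.getD (L.length / max c.1 2) 0) []).getD
      (L.length % max c.1 2) 0)) ?_ ?_
  · have hb : Primrec fun x : Code × List ℕ => max x.1.1 2 :=
      nat_max.comp (fst.comp fst) (const 2)
    have hl : Primrec fun x : Code × List ℕ => x.2.length := list_length.comp snd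
    refine Primrec.ite (Primrec.eq.comp hl (const 0))
      (option_some.comp (fst.comp (snd.comp fst))) (option_some.comp ?_)
    exact (list_getD 0).comp ((list_getD []).comp (fst.comp (snd.comp (snd.comp fst)))
      ((list_getD 0).comp snd (nat_div.comp hl hb))) (nat_mod.comp hl hb)
  · intro c n
    rw [codeState]
    by_cases h : n = 0
    · simp [h]
    · have hlt : n / max c.1 2 < n := Nat.div_lt_self (by omega) (by omega)
      simp [h, List.getD_eq_getElem?_getD, hlt]

theorem primrec_codeSeq : Primrec₂ codeSeq :=
  (list_getD 0).comp (snd.comp (snd.comp (snd.comp fst))) primrec_codeState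

theorem primrec_codeSize : Primrec codeSize := list_length.comp (snd.comp (snd.comp snd))

theorem primrec_factorStates : Primrec factorStates := by
  have h : Primrec fun q : ℕ => (q + 1) * (q + 1) := nat_mul.comp succ succ
  exact nat_pow.comp (const 2) (nat_mul.comp (nat_mul.comp h h) (const _))

theorem primrec_gapStates : Primrec gapStates := by
  have h : Primrec fun q : ℕ => factorStates q * factorStates q :=
    nat_mul.comp primrec_factorStates primrec_factorStates
  exact nat_mul.comp (nat_mul.comp h (const 2)) (nat_pow.comp (const 2)
    (nat_mul.comp (nat_mul.comp h (const _)) (const 2)))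

theorem primrec_gapPairStates : Primrec gapPairStates :=
  nat_mul.comp (nat_pow.comp (const 2) primrec_gapStates) (const 2)

theorem primrec_returnStates : Primrec returnStates :=
  nat_pow.comp (const 2) (nat_mul.comp primrec_factorStates (const _))

theorem primrec_ratioBound : Primrec₂ ratioBound :=
  nat_pow.comp fst (succ.comp (primrec_gapPairStates.comp snd))

theorem primrec_gapPairBound : Primrec₂ gapPairBound :=
  nat_pow.comp fst (succ.comp (nat_mul.comp (primrec_gapPairStates.comp snd)
    (succ.comp (nat_mul.comp (const 2) primrec_ratioBound))))

theorem primrec_factorBound : Primrec₂ factorBound :=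
  nat_pow.comp fst (succ.comp (primrec_returnStates.comp snd))

variable {α : Type*} [Primcodable α] {c : α → Code} {i j n l p q : α → ℕ}

theorem primrecPred_factorEq (hc : Primrec c) (hi : Primrec i) (hj : Primrec j)
    (hl : Primrec l) : PrimrecPred fun x => FactorEq (codeSeq (c x)) (i x) (j x) (l x) :=
  PrimrecPred.forall_lt_of_primrec (Primrec.eq.comp
    (primrec_codeSeq.comp (hc.comp fst) (nat_add.comp (hi.comp fst) snd))
    (primrec_codeSeq.comp (hc.comp fst) (nat_add.comp (hj.comp fst) snd))) hl

theorem primrecPred_isGapAt (hc : Primrec c) (hi : Primrec i) (hn : Primrec n)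
    (hl : Primrec l) : PrimrecPred fun x => IsGapAt (codeSeq (c x)) (i x) (n x) (l x) :=
  (nat_lt.comp (const 0) hn).and ((primrecPred_factorEq hc hi (nat_add.comp hi hn) hl).and
    (PrimrecPred.forall_lt_of_primrec ((nat_lt.comp (const 0) snd).imp
      (primrecPred_factorEq (hc.comp fst) (hi.comp fst) (nat_add.comp (hi.comp fst) snd)
        (hl.comp fst)).not) hn))

theorem primrecPred_codeRatioLe (hc : Primrec c) (hp : Primrec p) (hq : Primrec q) :
    PrimrecPred fun x => CodeRatioLe (c x) (p x) (q x) := by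
  have hB : Primrec fun x => gapPairBound (c x).1 (codeSize (c x)) :=
    primrec_gapPairBound.comp (fst.comp hc) (primrec_codeSize.comp hc)
  have hy : Primrec fun x : ((α × ℕ) × ℕ) × ℕ => x.1.1.1 := fst.comp (fst.comp fst)
  have hn : Primrec fun x : ((α × ℕ) × ℕ) × ℕ => x.1.1.2 := snd.comp (fst.comp fst)
  have hl : Primrec fun x : ((α × ℕ) × ℕ) × ℕ => x.1.2 := snd.comp fst
  refine PrimrecPred.forall_lt_of_primrec (PrimrecPred.forall_lt_of_primrec
    ((nat_lt.comp (const 0) snd).imp (PrimrecPred.forall_lt_of_primrec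
      ((primrecPred_isGapAt (hc.comp hy) snd hn hl).imp
        (nat_le.comp (nat_mul.comp (hq.comp hy) hn) (nat_mul.comp (hp.comp hy) hl))) ?_))
    (hB.comp fst)) hB
  exact nat_pow.comp (fst.comp (hc.comp (fst.comp fst)))
    (nat_add.comp (nat_add.comp (snd.comp fst) snd)
      (primrec_gapStates.comp (primrec_codeSize.comp (hc.comp (fst.comp fst)))))

theorem primrec_codeRatioBound (hc : Primrec c) :
    Primrec fun x => ratioBound (c x).1 (codeSize (c x)) :=
  primrec_ratioBound.comp (fst.comp hc) (primrec_codeSize.comp hc)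

theorem primrecPred_codeLinearlyRecurrent : PrimrecPred CodeLinearlyRecurrent :=
  PrimrecPred.exists_lt_of_primrec (PrimrecPred.exists_lt_of_primrec
    ((nat_lt.comp (const 0) snd).and
      (primrecPred_codeRatioLe (fst.comp fst) (snd.comp fst) snd))
    (primrec_codeRatioBound fst)) (primrec_codeRatioBound Primrec.id)

theorem primrecPred_codeRecurrent : PrimrecPred CodeRecurrent := by
  have hB : Primrec fun c : Code => factorBound c.1 (codeSize c) :=
    primrec_factorBound.comp fst primrec_codeSize
  refine PrimrecPred.forall_lt_of_primrec (PrimrecPred.forall_lt_of_primrec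
    (PrimrecPred.exists_lt_of_primrec ((nat_lt.comp (snd.comp (fst.comp fst)) snd).and
      (primrecPred_factorEq (fst.comp (fst.comp fst)) (snd.comp (fst.comp fst)) snd
        (snd.comp fst))) ?_) (hB.comp fst)) hB
  exact nat_pow.comp (fst.comp (fst.comp fst)) (nat_add.comp
    (nat_add.comp (snd.comp fst) snd)
    (primrec_returnStates.comp (primrec_codeSize.comp (fst.comp fst))))

theorem primrecPred_codeOptimal (hc : Primrec c) (hp : Primrec p) (hq : Primrec q) :
    PrimrecPred fun x => CodeOptimal (c x) (p x) (q x) := by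
  have hB := primrec_codeRatioBound hc
  refine ((nat_lt.comp hp hB).and (nat_lt.comp hq hB)).and
    (((nat_lt.comp (const 0) hq).and (primrecPred_codeRatioLe hc hp hq)).and
      (PrimrecPred.forall_lt_of_primrec (PrimrecPred.forall_lt_of_primrec
        ((nat_lt.comp (const 0) snd).imp ((primrecPred_codeRatioLe (hc.comp (fst.comp fst))
          (snd.comp fst) snd).imp ?_)) (hB.comp fst)) hB))
  exact nat_le.comp (nat_mul.comp (hp.comp (fst.comp fst)) snd)
    (nat_mul.comp (snd.comp fst) (hq.comp (fst.comp fst)))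

end Primrec

open Classical in
/-- The least recurrence constant, as a pair of numerator and denominator. -/
noncomputable def codeConstant (c : Code) : ℕ × ℕ :=
  -- Any optimal pair will do, since all have the same quotient.
  (Nat.findGreatest (fun m => CodeOptimal c m.unpair.1 m.unpair.2)
    (Nat.pair (ratioBound c.1 (codeSize c)) (ratioBound c.1 (codeSize c)))).unpair

theorem primrec_codeConstant : Primrec codeConstant := by
  classical
  have hB : Primrec fun c : Code => ratioBound c.1 (codeSize c) :=
    primrec_codeRatioBound Primrec.id
  refine Primrec.unpair.comp (Primrec.nat_findGreatest (Primrec₂.natPair.comp hB hB) ?_)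
  exact primrecPred_codeOptimal Primrec.fst (Primrec.fst.comp (Primrec.unpair.comp Primrec.snd))
    (Primrec.snd.comp (Primrec.unpair.comp Primrec.snd))

/-! ### Correctness on codes of automata -/

variable (M : DFAO)

theorem codeRatioLe_code_iff {p q : ℕ} (hp : p < ratioBound M.base M.numStates)
    (hq : q < ratioBound M.base M.numStates) :
    CodeRatioLe M.code p q ↔ ∀ n l, (n, l) ∈ gapPairs M.seq → q * n ≤ p * l := by
  rw [M.ratio_le_iff_bounded hp hq, CodeRatioLe, codeSize_code, codeSeq_code]
  rfl

theorem codeRecurrent_code_iff : CodeRecurrent M.code ↔ IsRecurrentSeq M.seq := by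
  rw [M.isRecurrentSeq_iff_bounded, CodeRecurrent, codeSize_code, codeSeq_code]
  rfl

theorem isRecurrenceConstant_div_iff {p q : ℕ} (hq : 0 < q) :
    IsRecurrenceConstant M.seq ((p : ℝ) / q) ↔
      ∀ n l, (n, l) ∈ gapPairs M.seq → q * n ≤ p * l := by
  have hq' : (0 : ℝ) < q := by exact_mod_cast hq
  rw [isRecurrenceConstant_iff, Prod.forall]
  refine forall₃_congr fun n l _ => ?_
  dsimp only
  rw [div_mul_eq_mul_div, le_div_iff₀ hq', mul_comm]
  exact_mod_cast Iff.rfl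

theorem codeLinearlyRecurrent_code_iff :
    CodeLinearlyRecurrent M.code ↔ IsLinearlyRecurrent M.seq := by
  rw [CodeLinearlyRecurrent, codeSize_code]
  constructor
  · rintro ⟨p, hp, q, hq, hq0, h⟩
    exact ⟨_, (M.isRecurrenceConstant_div_iff hq0).2 ((M.codeRatioLe_code_iff hp hq).1 h)⟩
  · rintro ⟨C, hC⟩
    obtain ⟨p, hp, q, hq, hq0, -, h⟩ := M.exists_ratio_of_isRecurrenceConstant hC
    exact ⟨p, hp, q, hq, hq0, (M.codeRatioLe_code_iff hp hq).2 h⟩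

theorem exists_codeOptimal (h : IsLinearlyRecurrent M.seq) : ∃ p q, CodeOptimal M.code p q := by
  classical
  set B := ratioBound M.base M.numStates with hB
  let D : Finset (ℕ × ℕ) := (Finset.range B ×ˢ Finset.range B).filter
    fun x => 0 < x.2 ∧ CodeRatioLe M.code x.1 x.2
  have memD : ∀ p q, (p, q) ∈ D ↔ (p < B ∧ q < B) ∧ 0 < q ∧ CodeRatioLe M.code p q := by
    intro p q
    simp only [D, Finset.mem_filter, Finset.mem_product, Finset.mem_range]
  obtain ⟨p₀, hp₀, q₀, hq₀, h₀⟩ := M.codeLinearlyRecurrent_code_iff.2 h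
  rw [codeSize_code] at hp₀ hq₀
  obtain ⟨⟨p, q⟩, hpq, hmin⟩ := D.exists_min_image (fun x => (x.1 : ℚ) / x.2)
    ⟨_, (memD p₀ q₀).2 ⟨⟨hp₀, hq₀⟩, h₀⟩⟩
  rw [memD] at hpq
  refine ⟨p, q, ?_⟩
  rw [CodeOptimal, codeSize_code]
  refine ⟨hpq.1, hpq.2, fun p' hp' q' hq' h0 hle => ?_⟩
  have := hmin _ ((memD p' q').2 ⟨⟨hp', hq'⟩, h0, hle⟩)
  dsimp only at this
  rw [div_le_div_iff₀ (by exact_mod_cast hpq.2.1) (by exact_mod_cast h0)] at this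
  exact_mod_cast this

theorem codeOptimal_codeConstant (h : IsLinearlyRecurrent M.seq) :
    CodeOptimal M.code (codeConstant M.code).1 (codeConstant M.code).2 := by
  classical
  obtain ⟨p, q, hpq⟩ := M.exists_codeOptimal h
  refine Nat.findGreatest_spec (P := fun m => CodeOptimal M.code m.unpair.1 m.unpair.2)
    (m := Nat.pair p q) ?_ (by rw [Nat.unpair_pair]; exact hpq)
  exact ((Nat.pair_lt_pair_left _ hpq.1.1).trans (Nat.pair_lt_pair_right _ hpq.1.2)).le

/-- Below any recurrence constant lies a fraction with small entries that is itself one, so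
minimality among small fractions is minimality among reals. -/
theorem isLeast_of_codeOptimal {p q : ℕ} (h : CodeOptimal M.code p q) :
    IsLeast {C : ℝ | IsRecurrenceConstant M.seq C} ((p : ℝ) / q) := by
  rw [CodeOptimal, codeSize_code] at h
  obtain ⟨⟨hp, hq⟩, ⟨hq0, hle⟩, hmin⟩ := h
  refine ⟨(M.isRecurrenceConstant_div_iff hq0).2 ((M.codeRatioLe_code_iff hp hq).1 hle),
    fun C hC => ?_⟩
  obtain ⟨p', hp', q', hq', hq0', hpC, h'⟩ := M.exists_ratio_of_isRecurrenceConstant hC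
  have h1 := hmin p' hp' q' hq' hq0' ((M.codeRatioLe_code_iff hp' hq').2 h')
  have hq0R : (0 : ℝ) < q := by exact_mod_cast hq0
  have hq0R' : (0 : ℝ) < q' := by exact_mod_cast hq0'
  calc (p : ℝ) / q ≤ p' / q' := by
        rw [div_le_div_iff₀ hq0R hq0R']
        exact_mod_cast h1
    _ ≤ C := by rwa [div_le_iff₀ hq0R']

theorem isLUB_iff_isLeast (C : ℝ) :
    IsLUB ((fun p : ℕ × ℕ => (p.1 : ℝ) / (p.2 : ℝ)) '' gapPairs M.seq) C ↔
      IsLeast {C : ℝ | IsRecurrenceConstant M.seq C} C := by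
  have : upperBounds ((fun p : ℕ × ℕ => (p.1 : ℝ) / (p.2 : ℝ)) '' gapPairs M.seq) =
      {C : ℝ | IsRecurrenceConstant M.seq C} := by
    ext D
    rw [mem_upperBounds, Set.forall_mem_image, Set.mem_ofPred_eq, isRecurrenceConstant_iff]
    refine forall₂_congr fun x hx => ?_
    rw [div_le_iff₀ (by exact_mod_cast hx.1)]
  rw [IsLUB, this]

end DFAO

/-! ### Encodings of pairs and regularity -/

theorem canonicalPairRep_zero (k : ℕ) (hk : 2 ≤ k) : canonicalPairRep k hk 0 0 = [] := by
  simp [canonicalPairRep, canonicalRep_zero]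

theorem leftpad_succ_canonicalRep (k : ℕ) (hk : 2 ≤ k) (x a len : ℕ) (ha : a < k)
    (hlen : (canonicalRep k hk x).length ≤ len) :
    (canonicalRep k hk (k * x + a)).leftpad (len + 1) ⟨0, by omega⟩ =
      (canonicalRep k hk x).leftpad len ⟨0, by omega⟩ ++ [⟨a, ha⟩] := by
  by_cases h : x ≠ 0 ∨ a ≠ 0
  · rw [canonicalRep_mul_add k hk x a ha h]
    simp [List.leftpad]
  · push Not at h
    obtain ⟨rfl, rfl⟩ := h
    simp [canonicalRep_zero, List.leftpad, List.replicate_succ']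

theorem length_canonicalRep_mul_add_le (k : ℕ) (hk : 2 ≤ k) (x a : ℕ) (ha : a < k) :
    (canonicalRep k hk (k * x + a)).length ≤ (canonicalRep k hk x).length + 1 := by
  by_cases h : x ≠ 0 ∨ a ≠ 0
  · rw [canonicalRep_mul_add k hk x a ha h]; simp
  · push Not at h
    simp [h.1, h.2, canonicalRep_zero]

theorem canonicalPairRep_mul_add (k : ℕ) (hk : 2 ≤ k) (x y : ℕ) (d : Fin k × Fin k)
    (h : (x ≠ 0 ∨ y ≠ 0) ∨ ((d.1 : ℕ) ≠ 0 ∨ (d.2 : ℕ) ≠ 0)) :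
    canonicalPairRep k hk (k * x + d.1) (k * y + d.2) = canonicalPairRep k hk x y ++ [d] := by
  have hlen : max (canonicalRep k hk (k * x + d.1)).length
      (canonicalRep k hk (k * y + d.2)).length =
      max (canonicalRep k hk x).length (canonicalRep k hk y).length + 1 := by
    have h1 := length_canonicalRep_mul_add_le k hk x d.1 d.1.2
    have h2 := length_canonicalRep_mul_add_le k hk y d.2 d.2.2
    have eq_succ : ∀ (z : ℕ) (b : Fin k), z ≠ 0 ∨ (b : ℕ) ≠ 0 →
        (canonicalRep k hk (k * z + b)).length = (canonicalRep k hk z).length + 1 := by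
      intro z b hz
      rw [canonicalRep_mul_add k hk z b b.2 hz]; simp
    have zero_len : (canonicalRep k hk 0).length = 0 := by simp [canonicalRep_zero]
    by_cases hx : x ≠ 0 ∨ (d.1 : ℕ) ≠ 0
    · have h3 := eq_succ x d.1 hx
      by_cases hy : y ≠ 0 ∨ (d.2 : ℕ) ≠ 0
      · have h4 := eq_succ y d.2 hy
        omega
      · push Not at hy
        have h4 : (canonicalRep k hk y).length = 0 := by rw [hy.1, zero_len]
        omega
    · have hy : y ≠ 0 ∨ (d.2 : ℕ) ≠ 0 := by tauto
      have h4 := eq_succ y d.2 hy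
      push Not at hx
      have h3 : (canonicalRep k hk x).length = 0 := by rw [hx.1, zero_len]
      omega
  simp only [canonicalPairRep]
  rw [hlen, leftpad_succ_canonicalRep k hk x _ _ d.1.2 (le_max_left _ _),
    leftpad_succ_canonicalRep k hk y _ _ d.2.2 (le_max_right _ _), List.zip_append]
  · rfl
  · simp [List.leftpad]

/-- The pair of numbers represented by a word over pairs of digits. -/
def pairValue (k : ℕ) (w : List (Fin k × Fin k)) : Fin 2 → ℕ :=
  w.foldl (fun v d => k • v + ![(d.1 : ℕ), (d.2 : ℕ)]) 0

theorem pairValue_concat (k : ℕ) (w : List (Fin k × Fin k)) (d : Fin k × Fin k) :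
    pairValue k (w ++ [d]) = k • pairValue k w + ![(d.1 : ℕ), (d.2 : ℕ)] := by
  simp [pairValue]

theorem canonicalPairRep_pairValue (k : ℕ) (hk : 2 ≤ k) (w : List (Fin k × Fin k))
    (hw : w.head? ≠ some (⟨0, by omega⟩, ⟨0, by omega⟩)) :
    canonicalPairRep k hk (pairValue k w 0) (pairValue k w 1) = w := by
  induction w using List.reverseRecOn with
  | nil => exact canonicalPairRep_zero k hk
  | append_singleton w d ih =>
    have h0 : pairValue k (w ++ [d]) 0 = k * pairValue k w 0 + d.1 := by simp [pairValue_concat]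
    have h1 : pairValue k (w ++ [d]) 1 = k * pairValue k w 1 + d.2 := by simp [pairValue_concat]
    rw [h0, h1]
    by_cases hnil : w = []
    · subst hnil
      rw [canonicalPairRep_mul_add]
      · simp [pairValue, canonicalPairRep_zero]
      · right
        by_contra! h
        exact hw (by simp [Prod.ext_iff, Fin.ext_iff, h.1, h.2])
    · have ih := ih (by rwa [List.head?_append_of_ne_nil _ hnil] at hw)
      rw [canonicalPairRep_mul_add, ih]
      left
      by_contra! h
      rw [h.1, h.2, canonicalPairRep_zero] at ih
      exact hnil ih.symm

/-- With `canonicalPairRep_pairValue`: the canonical encodings are exactly the words not beginning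
with a pair of zeros. -/
theorem canonicalPairRep_spec (k : ℕ) (hk : 2 ≤ k) (m n : ℕ) :
    (canonicalPairRep k hk m n).head? ≠ some (⟨0, by omega⟩, ⟨0, by omega⟩) ∧
      pairValue k (canonicalPairRep k hk m n) = ![m, n] := by
  induction hs : m + n using Nat.strong_induction_on generalizing m n with
  | _ s ih =>
    by_cases h0 : m = 0 ∧ n = 0
    · obtain ⟨rfl, rfl⟩ := h0
      rw [canonicalPairRep_zero]
      refine ⟨by simp, ?_⟩
      funext i
      fin_cases i <;> rfl
    have hk0 : 0 < k := by omega
    have hdiv : m / k + n / k < s := by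
      have h1 := Nat.div_le_self m k
      have h2 := Nat.div_le_self n k
      by_cases hm : m = 0
      · have := Nat.div_lt_self (Nat.pos_of_ne_zero fun hn => h0 ⟨hm, hn⟩) (by omega : 1 < k)
        omega
      · have := Nat.div_lt_self (Nat.pos_of_ne_zero hm) (by omega : 1 < k)
        omega
    obtain ⟨ih1, ih2⟩ := ih _ hdiv _ _ rfl
    let d : Fin k × Fin k := (⟨m % k, Nat.mod_lt _ hk0⟩, ⟨n % k, Nat.mod_lt _ hk0⟩)
    have hm : k * (m / k) + m % k = m := Nat.div_add_mod m k
    have hn : k * (n / k) + n % k = n := Nat.div_add_mod n k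
    have hd : (m / k ≠ 0 ∨ n / k ≠ 0) ∨ ((d.1 : ℕ) ≠ 0 ∨ (d.2 : ℕ) ≠ 0) := by
      by_contra! h
      obtain ⟨⟨h1, h2⟩, h3, h4⟩ := h
      dsimp only [d] at h3 h4
      rw [h1, h3] at hm
      rw [h2, h4] at hn
      omega
    have hrec : canonicalPairRep k hk m n = canonicalPairRep k hk (m / k) (n / k) ++ [d] := by
      rw [← canonicalPairRep_mul_add k hk _ _ d hd]
      simp only [d, hm, hn]
    rw [hrec, pairValue_concat, ih2]
    constructor
    · by_cases hnil : canonicalPairRep k hk (m / k) (n / k) = []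
      · rw [hnil] at ih2 ⊢
        have e0 : m / k = 0 := (congrFun ih2 0).symm
        have e1 : n / k = 0 := (congrFun ih2 1).symm
        intro h
        simp only [List.nil_append, List.head?_cons, Option.some.injEq, Prod.ext_iff,
          Fin.ext_iff] at h
        omega
      · rwa [List.head?_append_of_ne_nil _ hnil]
    · funext i
      fin_cases i
      · simpa [d] using hm
      · simpa [d] using hn

theorem mem_gapLanguage_iff (M : DFAO) (w : List (Fin M.base × Fin M.base)) :
    w ∈ gapLanguage M.base M.two_le_base M.seq ↔
      w.head? ≠ some (⟨0, by have := M.two_le_base; omega⟩, ⟨0, by have := M.two_le_base; omega⟩) ∧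
        M.gapPairState (pairValue M.base w) ∈ M.gapPairAccept := by
  constructor
  · rintro ⟨⟨n, l⟩, h, rfl⟩
    obtain ⟨h1, h2⟩ := canonicalPairRep_spec M.base M.two_le_base n l
    refine ⟨h1, ?_⟩
    rw [h2, M.gapPairState_mem_iff]
    exact h
  · rintro ⟨h1, h2⟩
    refine ⟨(pairValue M.base w 0, pairValue M.base w 1), ?_,
      (canonicalPairRep_pairValue M.base M.two_le_base w h1).symm⟩
    rw [← M.gapPairState_mem_iff]
    convert h2 using 2
    funext i
    fin_cases i <;> rfl

theorem DigitDetermined.map_pairValue_append {k : ℕ} {S : Type*} {f : (Fin 2 → ℕ) → S}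
    (hf : DigitDetermined k f) {w w' : List (Fin k × Fin k)}
    (h : f (pairValue k w) = f (pairValue k w')) (u : List (Fin k × Fin k)) :
    f (pairValue k (w ++ u)) = f (pairValue k (w' ++ u)) := by
  induction u using List.reverseRecOn with
  | nil => simpa using h
  | append_singleton u d ih =>
    rw [← List.append_assoc, ← List.append_assoc, pairValue_concat, pairValue_concat]
    refine hf _ _ ih _ fun i => ?_
    fin_cases i
    exacts [d.1.2, d.2.2]

theorem isRegular_gapLanguage (M : DFAO) :
    (gapLanguage M.base M.two_le_base M.seq).IsRegular := by
  rw [Language.isRegular_iff_finite_range_leftQuotient]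
  let h : List (Fin M.base × Fin M.base) →
      Option (Fin M.base × Fin M.base) × DFAO.GapPairState M.numStates :=
    -- The first letter is kept to reject noncanonical words, which the value alone cannot detect.
    fun w => (w.head?, M.gapPairState (pairValue M.base w))
  have hfac : Function.FactorsThrough
      (gapLanguage M.base M.two_le_base M.seq).leftQuotient h := by
    intro w w' hww
    rw [Prod.mk.injEq] at hww
    ext u
    rw [Language.mem_leftQuotient, Language.mem_leftQuotient, mem_gapLanguage_iff,
      mem_gapLanguage_iff, List.head?_append, List.head?_append, hww.1,
      M.digitDetermined_gapPairState.map_pairValue_append hww.2 u]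
  obtain ⟨e, he⟩ := (Function.factorsThrough_iff _).1 hfac
  rw [he]
  exact (Set.finite_range e).subset (Set.range_comp_subset_range h e)

theorem mainTheorem10 :
    (∃ dec : DFAO.Code → Bool, Computable dec ∧
      ∀ M : DFAO, dec M.code = true ↔ IsLinearlyRecurrent M.seq) ∧
    (∃ dec : DFAO.Code → Bool, Computable dec ∧
      ∀ M : DFAO, dec M.code = true ↔ (IsRecurrentSeq M.seq ∧ IsLinearlyRecurrent M.seq)) ∧
    (∀ M : DFAO, (gapLanguage M.base M.two_le_base M.seq).IsRegular) ∧
    (∃ opt : DFAO.Code → ℕ × ℕ, Computable opt ∧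
      ∀ M : DFAO, IsLinearlyRecurrent M.seq →
        (opt M.code).2 ≠ 0 ∧
        IsLeast {C : ℝ | IsRecurrenceConstant M.seq C}
          (((opt M.code).1 : ℝ) / ((opt M.code).2 : ℝ)) ∧
        IsLUB ((fun p : ℕ × ℕ => (p.1 : ℝ) / (p.2 : ℝ)) '' gapPairs M.seq)
          (((opt M.code).1 : ℝ) / ((opt M.code).2 : ℝ))) := by
  classical
  refine ⟨⟨fun c => decide (DFAO.CodeLinearlyRecurrent c),
      DFAO.primrecPred_codeLinearlyRecurrent.decide.to_comp, fun M => ?_⟩,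
    ⟨fun c => decide (DFAO.CodeRecurrent c ∧ DFAO.CodeLinearlyRecurrent c),
      (DFAO.primrecPred_codeRecurrent.and DFAO.primrecPred_codeLinearlyRecurrent).decide.to_comp,
      fun M => ?_⟩, isRegular_gapLanguage,
    ⟨DFAO.codeConstant, DFAO.primrec_codeConstant.to_comp, fun M hM => ?_⟩⟩
  · rw [decide_eq_true_iff, M.codeLinearlyRecurrent_code_iff]
  · rw [decide_eq_true_iff, M.codeRecurrent_code_iff, M.codeLinearlyRecurrent_code_iff]
  · have h := M.codeOptimal_codeConstant hM
    have hleast := M.isLeast_of_codeOptimal h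
    exact ⟨h.2.1.1.ne', hleast, (M.isLUB_iff_isLeast _).2 hleast⟩
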